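/- Let $K$ be a field of characteristic zero and let $\mathcal A$ be a commutative (associative, not necessarily unital) $K$-algebra. A $K$-linear map $\eta:\mathcal A\to\mathcal A$ is called locally nilpotent if for every $a\in\mathcal A$ there is $m\ge 1$ with $\eta^m(a)=0$, and locally finite if for every $a\in\mathcal A$ the $K$-subspace spanned by $\{\eta^i(a): i\ge 0\}$ is finite dimensional. A $K$-derivation of $\mathcal A$ is a $K$-linear map $D:\mathcal A\to\mathcal A$ with $D(ab)=D(a)b+aD(b)$ for all $a,b\in\mathcal A$, and a $K$-$\mathcal E$-derivation of $\mathcal A$ is a $K$-linear map $\delta:\mathcal A\to\mathcal A$ with $\delta(ab)=\delta(a)b+a\delta(b)-\delta(a)\delta(b)$ for all $a,b\in\mathcal A$. Let $\delta$ be a locally finite $K$-derivation of $\mathcal A$ or a locally nilpotent $K$-$\mathcal E$-derivation of $\mathcal A$, and let $e\in\operatorname{Im}\delta:=\delta(\mathcal A)$ be an idempotent, i.e. $e^2=e$. Then the principal ideal $(e)$ of $\mathcal A$ generated by $e$ is contained in $\operatorname{Im}\delta$. -/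

import Mathlib

section Endomorphisms

variable {K V : Type*} [Field K] [AddCommGroup V] [Module K V]

/-- A linear endomorphism `η` is locally nilpotent if every vector is killed by a positive power
of `η`. -/
def IsLocallyNilpotentEnd (η : V →ₗ[K] V) : Prop :=
  ∀ a : V, ∃ m : ℕ, 1 ≤ m ∧ (η ^ m) a = 0

/-- A linear endomorphism `η` is locally finite if, for every vector `a`, the subspace spanned by
`a, η a, η² a, …` is finite dimensional. -/
def IsLocallyFiniteEnd (η : V →ₗ[K] V) : Prop :=
  ∀ a : V, FiniteDimensional K (Submodule.span K (Set.range fun i : ℕ => (η ^ i) a))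

end Endomorphisms

section Derivations

variable {K A : Type*} [Field K] [NonUnitalRing A] [Module K A]

/-- `D` is a `K`-derivation of the (not necessarily unital or commutative) algebra `A`. -/
def IsKDerivation (D : A →ₗ[K] A) : Prop :=
  ∀ a b : A, D (a * b) = D a * b + a * D b

/-- `δ` is a `K`-`ℰ`-derivation of the (not necessarily unital or commutative) algebra `A`. -/
def IsEDerivation (δ : A →ₗ[K] A) : Prop :=
  ∀ a b : A, δ (a * b) = δ a * b + a * δ b - δ a * δ b

end Derivations

/-! Suppose `e` is an idempotent with `δ e = 0` and `e = δ s`. The divided powers of `s` (rising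
ones when `t = 1`), with `e` as unit, form a chain `s₀ = e`, `δ sₖ₊₁ = sₖ`. If `δ ^ m` kills `b`,
integrating by parts along this chain puts `e * b` in the image, and `e * b = b` on the ideal `(e)`.
For a locally finite derivation, Fitting splits `b = x + D y` with `x` killed by a power of `D`, and
`e * D y = D (e * y)`. It remains to see that `δ e = 0`. For a derivation, `D e = 2 e D e` gives it.
For an `ℰ`-derivation, `1 - δ` is an endomorphism, and the top Leibniz term of `e * e = e` settles
the reduced case; idempotents then lift uniquely modulo the nilradical. -/

section WeightedDerivations

variable {K A : Type*} [Field K] [NonUnitalCommRing A] [Module K A]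

/-- A differential operator of weight `-t`: for `t = 0` these are the derivations, and for `t = 1`
the `ℰ`-derivations. -/
def IsWeightedDerivation (t : K) (δ : A →ₗ[K] A) : Prop :=
  ∀ a b : A, δ (a * b) = δ a * b + a * δ b - t • (δ a * δ b)

theorem IsKDerivation.isWeightedDerivation {D : A →ₗ[K] A} (h : IsKDerivation D) :
    IsWeightedDerivation (0 : K) D := fun a b => by simp [h a b]

theorem IsEDerivation.isWeightedDerivation {δ : A →ₗ[K] A} (h : IsEDerivation δ) :
    IsWeightedDerivation (1 : K) δ := fun a b => by simp [h a b]

/-- The rising divided powers `s (s + t) ⋯ (s + (k - 1) t) / k!`, with `e` as the unit. -/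
def dividedRising (t : K) (e s : A) : ℕ → A
  | 0 => e
  | k + 1 => ((k : K) + 1)⁻¹ • ((s + (t * k) • e) * dividedRising t e s k)

theorem succ_smul_dividedRising_succ [CharZero K] (t : K) (e s : A) (k : ℕ) :
    ((k : K) + 1) • dividedRising t e s (k + 1) = (s + (t * k) • e) * dividedRising t e s k := by
  rw [dividedRising, smul_inv_smul₀ (Nat.cast_add_one_ne_zero k)]

variable [SMulCommClass K A A]

theorem mul_dividedRising (t : K) {e s : A} (he : e * e = e) (k : ℕ) :
    e * dividedRising t e s k = dividedRising t e s k := by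
  induction k with
  | zero => exact he
  | succ k ih => rw [dividedRising, mul_smul_comm, mul_left_comm, ih]

variable [IsScalarTower K A A] [CharZero K]

/-- For `t = 0` this is the derivative of `s ^ k / k!`; for `t = 1` it is the backward difference of
a rising factorial, as `1 - δ` sends `s` to `s - e`. -/
theorem IsWeightedDerivation.apply_dividedRising_succ {t : K} {δ : A →ₗ[K] A}
    (h : IsWeightedDerivation t δ) {e s : A} (he : e * e = e) (hδe : δ e = 0) (hs : δ s = e)
    (k : ℕ) : δ (dividedRising t e s (k + 1)) = dividedRising t e s k := by
  have key (k : ℕ) : δ (s + (t * k) • e) = e := by rw [map_add, map_smul, hs, hδe]; simp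
  induction k with
  | zero =>
    have := key 0
    simp_all [dividedRising, h _ e]
  | succ k ih =>
    rw [dividedRising.eq_2 t e s (k + 1), map_smul, h, key, ih, mul_dividedRising t he, mul_dividedRising t he,
      inv_smul_eq_iff₀ (Nat.cast_add_one_ne_zero _)]
    have h1 := succ_smul_dividedRising_succ t e s k
    have h2 := mul_dividedRising t (s := s) he k
    rw [add_mul, smul_mul_assoc, h2] at h1 ⊢
    push_cast
    have h3 : s * dividedRising t e s k =
        ((k : K) + 1) • dividedRising t e s (k + 1) - (t * k) • dividedRising t e s k := by
      rw [h1]; abel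
    rw [h3]
    module

theorem IsWeightedDerivation.mul_mem_range_of_pow_apply_eq_zero {t : K} {δ : A →ₗ[K] A}
    (h : IsWeightedDerivation t δ) {e : A} (he : e * e = e) (hδe : δ e = 0)
    (hmem : e ∈ LinearMap.range δ) {m : ℕ} {b : A} (hb : (δ ^ m) b = 0) :
    e * b ∈ LinearMap.range δ := by
  obtain ⟨s, hs⟩ := hmem
  -- All `k` are needed at once: integration by parts trades `b` for `δ b` but raises the index.
  suffices ∀ k, dividedRising t e s k * b ∈ LinearMap.range δ from this 0
  induction m generalizing b with
  | zero => simp_all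
  | succ m ih =>
    intro k
    have ih' := ih (b := δ b) (by rwa [pow_succ] at hb)
    have hk := h (dividedRising t e s (k + 1)) b
    rw [h.apply_dividedRising_succ he hδe hs] at hk
    have hk' : dividedRising t e s k * b = δ (dividedRising t e s (k + 1) * b)
        - dividedRising t e s (k + 1) * δ b + t • (dividedRising t e s k * δ b) := by
      rw [hk]; abel
    rw [hk']
    exact add_mem (sub_mem ⟨_, rfl⟩ (ih' _)) (Submodule.smul_mem _ _ (ih' _))

end WeightedDerivations

/-! ### Idempotents are constants -/

section ConstantIdempotents

theorem IsKDerivation.apply_eq_zero_of_isIdempotentElem {K A : Type*} [Field K]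
    [NonUnitalCommRing A] [Module K A] {D : A →ₗ[K] A} (h : IsKDerivation D) {e : A}
    (he : e * e = e) : D e = 0 := by
  have h1 : D e = e * D e + e * D e := by
    nth_rw 1 [← he]
    rw [h, mul_comm]
  have h2 : e * D e = 0 := by
    have := congrArg (e * ·) h1
    simpa [mul_add, ← mul_assoc, he] using this
  rw [h1, h2, add_zero]

/-- The top term of the Leibniz rule for an `ℰ`-derivation. -/
theorem IsEDerivation.pow_add_apply_mul {K A : Type*} [Field K] [NonUnitalCommRing A] [Module K A]
    {δ : A →ₗ[K] A} (h : IsEDerivation δ) (n m : ℕ) (a b : A)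
    (ha : (δ ^ (n + 1)) a = 0) (hb : (δ ^ (m + 1)) b = 0) :
    (δ ^ (n + m)) (a * b) = (n + m).choose n • ((δ ^ n) a * (δ ^ m) b) := by
  have pow_apply_succ (k : ℕ) (x : A) : (δ ^ (k + 1)) x = (δ ^ k) (δ x) := by rw [pow_succ]; rfl
  induction n generalizing m a b with
  | zero =>
    replace ha : δ a = 0 := by simpa using ha
    clear hb
    induction m generalizing b with
    | zero => simp
    | succ m ih =>
      rw [← add_assoc, pow_apply_succ, h, ha]
      simpa [pow_apply_succ] using ih (δ b)
  | succ n ihn =>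
    induction m generalizing b with
    | zero =>
      replace hb : δ b = 0 := by simpa using hb
      have := ihn 0 (δ a) b (by rwa [← pow_apply_succ]) (by simpa using hb)
      rw [add_zero, pow_apply_succ, h, hb]
      simpa [pow_apply_succ] using this
    | succ m ihm =>
      have ha' : (δ ^ (n + 1)) (δ a) = 0 := by rwa [← pow_apply_succ]
      have hb' : (δ ^ (m + 1)) (δ b) = 0 := by rwa [← pow_apply_succ]
      have h1 := ihn (m + 1) (δ a) b ha' hb
      have h2 := ihm (δ b) hb'
      have h3 := ihn m (δ a) (δ b) ha' hb'
      -- The correction term dies: `δ ^ (n + m)` already turns it into a multiple of a product of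
      -- two constants. The two remaining terms add up by Pascal's rule.
      have h4 : (δ ^ (n + m + 1)) (δ a * δ b) = 0 := by
        rw [pow_succ']
        change δ ((δ ^ (n + m)) (δ a * δ b)) = 0
        rw [h3, map_nsmul, h, ← pow_apply_succ, ← pow_apply_succ]
        have e1 : δ ((δ ^ (n + 1)) a) = 0 := by
          rw [← ha, pow_succ' δ (n + 1)]; rfl
        have e2 : δ ((δ ^ (m + 1)) b) = 0 := by
          rw [← hb, pow_succ' δ (m + 1)]; rfl
        simp [e1, e2]
      rw [show n + 1 + (m + 1) = (n + m + 1) + 1 by ring, pow_apply_succ, h, map_sub, map_add, h4,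
        sub_zero]
      rw [show n + (m + 1) = n + m + 1 by ring] at h1
      rw [show n + 1 + m = n + m + 1 by ring] at h2
      rw [h1, h2, ← pow_apply_succ, ← pow_apply_succ, Nat.choose_succ_succ (n + m + 1) n, add_smul]

theorem AlgHom.isEDerivation_one_sub {K R : Type*} [Field K] [CommRing R] [Algebra K R]
    (φ : R →ₐ[K] R) : IsEDerivation (1 - φ.toLinearMap : Module.End K R) := fun a b => by
  simp only [LinearMap.sub_apply, Module.End.one_apply, AlgHom.toLinearMap_apply, map_mul]
  ring

theorem IsEDerivation.apply_eq_zero_of_isReduced {K R : Type*} [Field K] [CharZero K] [CommRing R]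
    [Algebra K R] [IsReduced R] {δ : R →ₗ[K] R} (h : IsEDerivation δ) {e : R} (he : e * e = e)
    {n : ℕ} (hn : (δ ^ n) e = 0) : δ e = 0 := by
  induction n with
  | zero =>
    rw [show e = 0 by simpa using hn, map_zero]
  | succ n ih =>
    -- The squaring argument needs twice the top exponent to reach the vanishing order, which fails
    -- for top exponent `0`.
    rcases n with _ | n
    · simpa using hn
    refine ih ?_
    have h1 := h.pow_add_apply_mul (n + 1) (n + 1) e e hn hn
    have h2 : (δ ^ (n + 1 + (n + 1))) e = 0 := by
      rw [show n + 1 + (n + 1) = n + (n + 1 + 1) by ring, pow_add, Module.End.mul_apply, hn,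
        map_zero]
    rw [he, h2, ← Nat.cast_smul_eq_nsmul K, eq_comm, smul_eq_zero_iff_right] at h1
    · exact pow_eq_zero_iff two_ne_zero |>.mp (by rwa [sq])
    · exact Nat.cast_ne_zero.mpr (Nat.choose_pos (Nat.le_add_right _ _)).ne'

/-- The reduced case makes `e - φ e` nilpotent, and a nilpotent difference of two commuting
idempotents is zero. -/
theorem AlgHom.apply_eq_self_of_isIdempotentElem {K R : Type*} [Field K] [CharZero K] [CommRing R]
    [Algebra K R] (φ : R →ₐ[K] R) {e : R} (he : e * e = e) {n : ℕ}
    (hn : ((1 - φ.toLinearMap : Module.End K R) ^ n) e = 0) : φ e = e := by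
  have hle : nilradical R ≤ (nilradical R).comap φ := fun x hx => IsNilpotent.map hx φ
  let ψ : (R ⧸ nilradical R) →ₐ[K] (R ⧸ nilradical R) := Ideal.quotientMapₐ _ φ hle
  have : IsReduced (R ⧸ nilradical R) :=
    (Ideal.isRadical_iff_quotient_reduced _).mp (Ideal.radical_isRadical _)
  have hmk (m : ℕ) (x : R) : ((1 - ψ.toLinearMap : Module.End K (R ⧸ nilradical R)) ^ m)
      (Ideal.Quotient.mk (nilradical R) x) =
      Ideal.Quotient.mk (nilradical R) (((1 - φ.toLinearMap : Module.End K R) ^ m) x) := by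
    induction m generalizing x with
    | zero => rfl
    | succ m ih =>
      rw [pow_succ, pow_succ, Module.End.mul_apply, Module.End.mul_apply, ← ih]
      rfl
  have h1 := ψ.isEDerivation_one_sub.apply_eq_zero_of_isReduced
    (e := Ideal.Quotient.mk (nilradical R) e) (by rw [← map_mul, he]) (n := n)
    (by rw [hmk, hn, map_zero])
  have h2 := hmk 1 e
  rw [pow_one, pow_one, h1, eq_comm, Ideal.Quotient.eq_zero_iff_mem, mem_nilradical] at h2
  obtain ⟨k, hk⟩ := h2
  have hφ : φ e * φ e = φ e := by rw [← map_mul, he]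
  replace hk : (e - φ e) ^ k = 0 := hk
  -- A difference of commuting idempotents satisfies `x ^ 3 = x`, so it equals all its odd powers.
  have hcube : (e - φ e) ^ 3 = e - φ e := by
    linear_combination (e + 1 - 3 * φ e) * he + (3 * e - φ e - 1) * hφ
  have hpow (j : ℕ) : (e - φ e) ^ (2 * j + 1) = e - φ e := by
    induction j with
    | zero => simp
    | succ j ih => rw [show 2 * (j + 1) + 1 = (2 * j + 1) + 2 by ring, pow_add, ih, ← pow_succ', hcube]
  have h0 : e - φ e = 0 := by
    rw [← hpow k, show 2 * k + 1 = k + (k + 1) by ring, pow_add, hk, zero_mul]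
  exact (sub_eq_zero.mp h0).symm

theorem IsEDerivation.apply_eq_zero_of_isIdempotentElem {K A : Type*} [Field K] [CharZero K]
    [NonUnitalCommRing A] [Module K A] [IsScalarTower K A A] [SMulCommClass K A A]
    {δ : A →ₗ[K] A} (h : IsEDerivation δ) {e : A} (he : e * e = e) {n : ℕ}
    (hn : (δ ^ n) e = 0) : δ e = 0 := by
  let φ : A →ₙₐ[K] A :=
    { toFun := fun a => a - δ a
      map_smul' := fun c a => by simp [smul_sub]
      map_zero' := by simp
      map_add' := fun a b => by rw [map_add]; abel
      map_mul' := fun a b => by rw [h, sub_mul, mul_sub, mul_sub]; abel }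
  -- Adjoining a unit extends `1 - δ` to a unital algebra, where the nilradical quotient is
  -- available.
  let Φ : Unitization K A →ₐ[K] Unitization K A :=
    Unitization.lift ((Unitization.inrNonUnitalAlgHom K A).comp φ)
  have hΦ (a : A) : Φ (a : Unitization K A) = ((a - δ a : A) : Unitization K A) := by
    simp [Φ, φ]
  have hpow (m : ℕ) (a : A) : ((1 - Φ.toLinearMap : Module.End K (Unitization K A)) ^ m) a =
      (((δ ^ m) a : A) : Unitization K A) := by
    induction m generalizing a with
    | zero => rfl
    | succ m ih =>
      rw [pow_succ, pow_succ, Module.End.mul_apply, Module.End.mul_apply, ← ih]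
      simp [hΦ]
  have h1 := Φ.apply_eq_self_of_isIdempotentElem (e := (e : Unitization K A))
    (by rw [← Unitization.inr_mul, he]) (n := n) (by rw [hpow, hn, Unitization.inr_zero])
  rw [hΦ] at h1
  simpa using Unitization.inr_injective h1

end ConstantIdempotents

/-- Fitting decomposition of a single vector under a locally finite endomorphism. -/
theorem IsLocallyFiniteEnd.exists_eq_add {K V : Type*} [Field K] [AddCommGroup V] [Module K V]
    {η : V →ₗ[K] V} (h : IsLocallyFiniteEnd η) (v : V) :
    ∃ (m : ℕ) (x y : V), (η ^ m) x = 0 ∧ v = x + η y := by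
  let W := Submodule.span K (Set.range fun i : ℕ => (η ^ i) v)
  have : FiniteDimensional K W := h v
  have hW : ∀ w ∈ W, η w ∈ W := by
    change W ≤ W.comap η
    refine Submodule.span_le.mpr ?_
    rintro _ ⟨i, rfl⟩
    refine Submodule.subset_span ⟨i + 1, ?_⟩
    simp [pow_succ']
  let f : Module.End K W := η.restrict hW
  have hf (k : ℕ) (w : W) : ((f ^ k) w : V) = (η ^ k) w := by
    induction k generalizing w with
    | zero => rfl
    | succ k ih => rw [pow_succ, pow_succ, Module.End.mul_apply, Module.End.mul_apply, ih]; rfl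
  obtain ⟨N, hN⟩ := Filter.eventually_atTop.mp f.eventually_isCompl_ker_pow_range_pow
  have hv : v ∈ W := Submodule.subset_span ⟨0, by simp⟩
  -- The exponent `N + 1` is positive, so the range component has the form `η y`.
  have htop : (⟨v, hv⟩ : W) ∈
      LinearMap.ker (f ^ (N + 1)) ⊔ LinearMap.range (f ^ (N + 1)) := by
    rw [(hN (N + 1) (Nat.le_succ N)).sup_eq_top]; trivial
  obtain ⟨x, hx, _, ⟨y, rfl⟩, hxy⟩ := Submodule.mem_sup.mp htop
  refine ⟨N + 1, x, (η ^ N) y, ?_, ?_⟩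
  · rw [← hf, LinearMap.mem_ker.mp hx]; rfl
  · rw [← Module.End.mul_apply, ← pow_succ', ← hf]
    exact (congrArg Subtype.val hxy).symm

theorem mul_eq_self_of_mem_span_singleton {A : Type*} [NonUnitalCommRing A] {e : A}
    (he : e * e = e) {b : A} (hb : b ∈ TwoSidedIdeal.span {e}) : e * b = b := by
  induction hb using TwoSidedIdeal.span_induction with
  | mem x hx => rw [Set.mem_singleton_iff.mp hx, he]
  | zero => rw [mul_zero]
  | add x y _ _ hx hy => rw [mul_add, hx, hy]
  | neg x _ hx => rw [mul_neg, hx]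
  | left_absorb a x _ hx => rw [mul_left_comm, hx]
  | right_absorb a x _ hx => rw [← mul_assoc, hx]

/-- `A` is a commutative, associative, not necessarily unital `K`-algebra, and
`TwoSidedIdeal.span {e}` is the principal ideal generated by `e`. -/
theorem corollary1p3 {K A : Type*} [Field K] [CharZero K] [NonUnitalCommRing A] [Module K A]
    [IsScalarTower K A A] [SMulCommClass K A A] :
    (∀ D : A →ₗ[K] A, IsKDerivation D → IsLocallyFiniteEnd D →
      ∀ e : A, e ∈ LinearMap.range D → IsIdempotentElem e →
        (TwoSidedIdeal.span {e} : Set A) ⊆ (LinearMap.range D : Set A)) ∧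
    (∀ δ : A →ₗ[K] A, IsEDerivation δ → IsLocallyNilpotentEnd δ →
      ∀ e : A, e ∈ LinearMap.range δ → IsIdempotentElem e →
        (TwoSidedIdeal.span {e} : Set A) ⊆ (LinearMap.range δ : Set A)) := by
  refine ⟨fun D hD hfin e hmem he b hb => ?_, fun δ hδ hnil e hmem he b hb => ?_⟩
  · have hDe := hD.apply_eq_zero_of_isIdempotentElem he
    obtain ⟨m, x, y, hx, rfl⟩ := hfin.exists_eq_add b
    rw [SetLike.mem_coe, ← mul_eq_self_of_mem_span_singleton he hb, mul_add]
    refine add_mem (hD.isWeightedDerivation.mul_mem_range_of_pow_apply_eq_zero he hDe hmem hx)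
      ⟨e * y, ?_⟩
    -- Since `D e = 0`, multiplication by `e` commutes with `D`.
    rw [hD, hDe, zero_mul, zero_add]
  · obtain ⟨n, -, hn⟩ := hnil e
    obtain ⟨m, -, hm⟩ := hnil b
    rw [SetLike.mem_coe, ← mul_eq_self_of_mem_span_singleton he hb]
    exact hδ.isWeightedDerivation.mul_mem_range_of_pow_apply_eq_zero he
      (hδ.apply_eq_zero_of_isIdempotentElem he hn) hmem hm
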